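/- **Corollary 2.2.** Let $n,u\ge 0$ be integers and let $\lambda=(\lambda_1,\dots,\lambda_n)$ be a partition of $n$, padded with zeros to $n$ parts. Let $H_\kappa$ be the product of the hook lengths of all cells of the Young diagram of a partition $\kappa$, and put $$A_\lambda(u)=\frac{1}{H_\lambda}\prod_{i=1}^n(\lambda_i+n-i+u).$$ Let $\lambda'=(\lambda_1',\dots,\lambda_n')$ be the conjugate of $\lambda$ and, for $v\ge 0$, let $\mu^{(v)}=(n^v,\lambda_1',\dots,\lambda_n')\vdash (v+1)n$; write $\mu=\mu^{(u)}$. (a) If $u\ge1$, then $A_\lambda(u)$ is the product of the hook lengths $h_v(\mu)$ of the cells $v$ in the top row of $\mu$ divided by $H_{\lambda'}$, and likewise divided by $H_\lambda$: $$A_\lambda(u)=\frac{1}{H_{\lambda'}}\prod_{v\in\text{top row of }\mu}h_v(\mu)=\frac{1}{H_\lambda}\prod_{v\in\text{top row of }\mu}h_v(\mu)=\frac{H_{\mu}}{H_\lambda\,H_{\mu^{(u-1)}}}.$$ In particular, for $u=1$, $A_\lambda(1)=H_\mu/H_\lambda^2$. (b) For every $u\ge 0$, $$A_\lambda(u)=\sum_{i=0}^n\binom{u+n-i-1}{n-i}f^{\lambda/1^i},$$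 where $f^{\lambda/1^i}$ is the number of standard Young tableaux of skew shape $\lambda/1^i$ (zero if $1^i\not\subseteq\lambda$), and $\binom{x}{k}=x(x-1)\cdots(x-k+1)/k!$, so that $\binom{-1}{0}=1$. Consequently $A_\lambda(u)$ is an integer. -/

import Mathlib

/-- The hook length `h_v` of the cell `v = (i, j)` (row `i`, column `j`, counted from `0`) of a
Young diagram: arm length, plus leg length, plus one. -/
def hookLength (lam : YoungDiagram) (v : ℕ × ℕ) : ℕ :=
  (lam.rowLen v.1 - v.2 - 1) + (lam.colLen v.2 - v.1 - 1) + 1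

/-- `H_λ`, the product of the hook lengths of all cells of `λ`. -/
def hookProduct (lam : YoungDiagram) : ℕ :=
  ∏ v ∈ lam.cells, hookLength lam v

/-- `φ_λ(x) = ∏_{i=1}^n (λ_i + n - i + x)` where `n = |λ|`; the part `λ_i` (zero beyond the length
of `λ`) is `lam.rowLen (i - 1)`. -/
def shiftedPartsProduct (lam : YoungDiagram) (x : ℚ) : ℚ :=
  ∏ i ∈ Finset.Icc 1 lam.card, ((lam.rowLen (i - 1) : ℚ) + (lam.card : ℚ) - (i : ℚ) + x)

/-- `A_λ(x) = φ_λ(x) / H_λ`. -/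
def shiftedHookQuotient (lam : YoungDiagram) (x : ℚ) : ℚ :=
  shiftedPartsProduct lam x / (hookProduct lam : ℚ)

theorem colLen_le_card (lam : YoungDiagram) (j : ℕ) : lam.colLen j ≤ lam.card := by
  rw [YoungDiagram.colLen_eq_card]
  exact Finset.card_le_card (Finset.filter_subset _ _)

theorem sortedGE_stacked (u : ℕ) (lam : YoungDiagram) :
    (List.replicate u lam.card ++ (List.range lam.card).map lam.colLen).SortedGE := by
  apply List.Pairwise.sortedGE
  rw [List.pairwise_append]
  refine ⟨?_, ?_, ?_⟩
  · exact List.pairwise_replicate_of_refl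
  · rw [List.pairwise_map]
    exact List.pairwise_lt_range.imp fun h => lam.colLen_anti _ _ h.le
  · intro a ha b hb
    rw [List.eq_of_mem_replicate ha]
    obtain ⟨j, -, rfl⟩ := List.mem_map.1 hb
    exact colLen_le_card lam j

/-- The Young diagram of `(n^u, λ'_1, …, λ'_n)`, where `n = |λ|` and `λ'` is the conjugate of `λ`
(so that `λ'_j` is the length of the `j`-th column of `λ`). -/
def stackedDiagram (u : ℕ) (lam : YoungDiagram) : YoungDiagram :=
  YoungDiagram.ofRowLens (List.replicate u lam.card ++ (List.range lam.card).map lam.colLen)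
    (sortedGE_stacked u lam)

/-- The Young diagram of the one-column partition `1^i`. -/
def columnDiagram (i : ℕ) : YoungDiagram :=
  YoungDiagram.ofRowLens (List.replicate i 1)
    (List.Pairwise.sortedGE List.pairwise_replicate_of_refl)

/-- A filling of the cells of `λ/κ` by the numbers `0, …, N - 1`, each used once (`N` being the
number of these cells), is a standard Young tableau when it increases along every row and down
every column. -/
def IsStandardFilling (lam kap : YoungDiagram)
    (T : {c // c ∈ lam.cells \ kap.cells} ≃ Fin (lam.cells \ kap.cells).card) : Prop :=
  (∀ c d, c.1.1 = d.1.1 → c.1.2 < d.1.2 → T c < T d) ∧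
    (∀ c d, c.1.2 = d.1.2 → c.1.1 < d.1.1 → T c < T d)

open Classical in
/-- `f^{λ/κ}`, the number of standard Young tableaux of skew shape `λ/κ`; it is `0` unless
`κ ⊆ λ`. -/
noncomputable def skewSYTCount (lam kap : YoungDiagram) : ℕ :=
  if kap ≤ lam then Nat.card {T // IsStandardFilling lam kap T} else 0

/-!
Part (a) is read off the diagram `μ = (n^u, λ')`: column `j` of `μ` has `u + λ_j` cells, so the hook
of the cell `j` in the top row is the factor `λ_j + n - j + u` of `φ_λ(u)`, and deleting the top row
leaves all other hook lengths unchanged (`shiftedPartsProduct_eq_prod_row`,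
`hookProduct_stackedDiagram_succ`).

For part (b), both sides `G_λ(u)` satisfy the difference equation
`G_λ(u) - G_λ(u - 1) = ∑_c G_{λ∖c}(u)`, the sum being over the corners `c` of `λ`, and
`G_λ(0)` is `1` if `λ = 1^n` and `0` otherwise; so they agree by induction on `n` and `u`.

* For the sum over skew tableaux this is Pascal's rule together with the branching rule
  `f^{λ/κ} = ∑_c f^{(λ∖c)/κ}`, which locates the largest entry (`skewSYTSum_succ_sub`,
  `skewSYTCount_eq_sum_corners`).
* For `A_λ`, let `λ` have at most `M = n - 1` rows and put `x_i = λ_i + M - i`. In each row, the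
  hook lengths and the differences `x_r - x_k` (`k > r`) partition `{1, …, x_r}`, whence
  `H_λ = ∏ x_r! / ∏_{i<k} (x_i - x_k)` and
  `H_λ / H_{λ∖c} = x_r ∏_{j≠r} (x_r - 1 - x_j) / (x_r - x_j)` for the corner `c` in row `r`.
  The difference equation becomes the identity `shifted_prod_sub` between polynomials in `u`. It
  follows by Lagrange interpolation, at the nodes `-x_i`, of the remainder of `u ∏ (u + x_i + 1)`
  modulo `∏ (u + x_i)`; its top coefficient encodes `∑_c H_λ / H_{λ∖c} = n`. The remaining
  case `λ = 1^n` is a direct computation (`shiftedHookQuotient_sub`).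
-/

/-! ### A partial fraction identity -/

open Polynomial in
/-- The remainder of `X ∏ (X + xᵢ + 1)` modulo `∏ (X + xᵢ)`, with its top coefficient. -/
theorem exists_remainder_shift {K ι : Type*} [Field K] [DecidableEq ι] (s : Finset ι) (x : ι → K) :
    ∃ B : K[X], X * ∏ i ∈ s, (X + C (x i + 1)) =
        (X + C (s.card : K)) * ∏ i ∈ s, (X + C (x i)) + B ∧
      B.degree < s.card ∧ B.coeff (s.card - 1) = (s.card.choose 2 : K) - ∑ i ∈ s, x i := by
  induction s using Finset.induction_on with
  | empty => exact ⟨0, by simp, by simp, by simp⟩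
  | insert a s ha ih =>
    obtain ⟨B, hB, hdeg, hcoeff⟩ := ih
    set Q : K[X] := ∏ i ∈ s, (X + C (x i)) with hQ
    have hQm : Q.Monic := monic_prod_of_monic _ _ fun i _ => monic_X_add_C _
    have hQd : Q.natDegree = s.card := by
      rw [hQ, natDegree_prod_of_monic _ _ fun i _ => monic_X_add_C _]
      simp
    have hQd' : Q.degree = s.card := by rw [degree_eq_natDegree hQm.ne_zero, hQd]
    have hQc : Q.coeff s.card = 1 := by rw [← hQd]; exact hQm
    have hBc : B.coeff s.card = 0 := coeff_eq_zero_of_degree_lt hdeg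
    refine ⟨(X + C (x a + 1)) * B + C ((s.card : K) - x a) * Q, ?_, ?_, ?_⟩
    · rw [Finset.prod_insert ha, Finset.prod_insert ha, Finset.card_insert_of_notMem ha, ← hQ]
      simp only [map_add, map_sub, map_one, Nat.cast_add, Nat.cast_one] at hB ⊢
      linear_combination (X + C (x a) + 1) * hB
    · rw [Finset.card_insert_of_notMem ha]
      refine (degree_add_le _ _).trans_lt (max_lt ?_ ?_)
      · rw [degree_mul, degree_X_add_C, add_comm, Nat.cast_add, Nat.cast_one]
        exact WithBot.add_lt_add_right (by simp) hdeg
      · rw [degree_mul, hQd']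
        refine (add_le_add_left degree_C_le _).trans_lt ?_
        rw [zero_add]
        exact_mod_cast Nat.lt_succ_self _
    · rw [Finset.card_insert_of_notMem ha, Finset.sum_insert ha, Nat.add_sub_cancel, coeff_add,
        coeff_C_mul, hQc, add_mul, coeff_add, coeff_C_mul, hBc]
      have hX : (X * B).coeff s.card = B.coeff (s.card - 1) := by
        rcases Nat.eq_zero_or_pos s.card with h0 | h0
        · rw [h0] at hBc ⊢
          simp [hBc]
        · obtain ⟨m, hm⟩ := Nat.exists_eq_add_of_le' h0
          rw [hm, coeff_X_mul, Nat.add_sub_cancel]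
      rw [hX, hcoeff, Nat.choose_succ_succ' s.card 1, Nat.choose_one_right]
      push_cast
      ring

/-- The ratio `H_λ / H_{λ∖c}` for the corner `c` in row `r`, in terms of the shifted row
lengths `xᵢ`. -/
def cornerWeight {K ι : Type*} [Field K] [DecidableEq ι] (s : Finset ι) (x : ι → K) (r : ι) : K :=
  x r * ∏ j ∈ s.erase r, ((x r - 1 - x j) / (x r - x j))

open Polynomial in
/-- Lagrange interpolation of the remainder of `X ∏ (X + xᵢ + 1)` at the nodes `-xᵢ`, where its
values are corner weights up to the nodal factors: comparison of top coefficients gives the sum of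
the weights, evaluation at `u` the expansion. -/
theorem sum_cornerWeight_and_shifted_prod {K ι : Type*} [Field K] [DecidableEq ι] (s : Finset ι)
    (x : ι → K) (hx : Set.InjOn x s) :
    (∑ r ∈ s, cornerWeight s x r = ∑ i ∈ s, x i - (s.card.choose 2 : K)) ∧
    ∀ u : K, u * ∏ i ∈ s, (x i + 1 + u) = (u + s.card) * ∏ i ∈ s, (x i + u) -
      ∑ r ∈ s, cornerWeight s x r * ∏ j ∈ s.erase r, (x j + u) := by
  obtain ⟨B, hB, hdeg, hcoeff⟩ := exists_remainder_shift s x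
  have hv : Set.InjOn (fun i => -x i) (s : Set ι) := fun i hi j hj h => hx hi hj (neg_inj.1 h)
  have heval : ∀ u : K, u * ∏ i ∈ s, (x i + 1 + u) =
      (u + s.card) * ∏ i ∈ s, (x i + u) + B.eval u := by
    intro u
    have := congrArg (eval u) hB
    simpa [eval_prod, add_comm, add_left_comm, add_assoc] using this
  have hne : ∀ r ∈ s, ∀ j ∈ s.erase r, x r - x j ≠ 0 := fun r hr j hj => by
    rw [Finset.mem_erase] at hj
    exact sub_ne_zero.2 fun h => hj.1 (hx hj.2 hr h.symm)
  -- At the node `-x r` the multiple of `∏ (X + xᵢ)` vanishes.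
  have hnode : ∀ r ∈ s, B.eval (-x r) = -x r * ∏ j ∈ s.erase r, (x j + 1 - x r) := by
    intro r hr
    have h := heval (-x r)
    have h0 : ∏ i ∈ s, (x i + -x r) = 0 := Finset.prod_eq_zero hr (add_neg_cancel (x r))
    rw [h0, ← Finset.mul_prod_erase s _ hr] at h
    rw [mul_zero, zero_add] at h
    rw [← h]
    simp [sub_eq_add_neg]
  have hw : ∀ r ∈ s, cornerWeight s x r =
      x r * ((∏ j ∈ s.erase r, (x j + 1 - x r)) / ∏ j ∈ s.erase r, (x j - x r)) := by
    intro r hr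
    rw [cornerWeight, ← Finset.prod_div_distrib]
    congr 1
    refine Finset.prod_congr rfl fun j hj => ?_
    rw [← neg_div_neg_eq]
    congr 1 <;> ring
  constructor
  · have h := Lagrange.coeff_eq_sum hv hdeg
    rw [hcoeff] at h
    rw [← neg_sub, h, ← Finset.sum_neg_distrib]
    refine Finset.sum_congr rfl fun r hr => ?_
    rw [hnode r hr, hw r hr]
    have : ∀ j, -x r - -x j = x j - x r := fun j => by ring
    simp only [this]
    ring
  · intro u
    rw [heval, sub_eq_add_neg]
    congr 1
    conv_lhs => rw [Lagrange.eq_interpolate hv hdeg]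
    rw [Lagrange.interpolate_apply, eval_finsetSum, ← Finset.sum_neg_distrib]
    refine Finset.sum_congr rfl fun r hr => ?_
    rw [eval_mul, eval_C, hnode r hr, hw r hr, Lagrange.basis, eval_prod]
    have : ∀ j, eval u (Lagrange.basisDivisor (-x r) (-x j)) = (x j + u) / (x j - x r) := by
      intro j
      simp only [Lagrange.basisDivisor, eval_mul, eval_C, eval_sub, eval_X]
      rw [div_eq_inv_mul]
      congr 1
      · congr 1; ring
      · ring
    simp only [this]
    rw [Finset.prod_div_distrib]
    ring

/-- The difference equation in `u` satisfied by `u ∏ (xᵢ + 1 + u)`. The hypothesis on `∑ xᵢ` says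
that the `xᵢ` are the shifted row lengths of a partition of `|s| + 1`. -/
theorem shifted_prod_sub {K ι : Type*} [Field K] [DecidableEq ι] (s : Finset ι)
    (x : ι → K) (hx : Set.InjOn x s) (hsum : ∑ i ∈ s, x i = s.card + 1 + (s.card.choose 2 : K))
    (u : K) :
    u * ∏ i ∈ s, (x i + 1 + u) - (u - 1) * ∏ i ∈ s, (x i + u) =
      ∑ r ∈ s, cornerWeight s x r * ∏ j ∈ s, (x j + u - if j = r then 1 else 0) := by
  obtain ⟨h1, h2⟩ := sum_cornerWeight_and_shifted_prod s x hx
  have h3 : ∀ r ∈ s, cornerWeight s x r * ∏ j ∈ s, (x j + u - if j = r then 1 else 0) =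
      cornerWeight s x r * ∏ i ∈ s, (x i + u) -
        cornerWeight s x r * ∏ j ∈ s.erase r, (x j + u) := by
    intro r hr
    rw [← Finset.mul_prod_erase s _ hr, ← Finset.mul_prod_erase s (fun i => x i + u) hr, if_pos rfl,
      Finset.prod_congr rfl fun j hj => by
        rw [if_neg (Finset.ne_of_mem_erase hj), sub_zero]]
    ring
  rw [Finset.sum_congr rfl h3, Finset.sum_sub_distrib, ← Finset.sum_mul, h1, h2, hsum]
  ring

/-! ### Hook lengths and shifted row lengths -/

theorem eq_of_forall_lt_iff_lt {a b : ℕ} (h : ∀ m, m < a ↔ m < b) : a = b :=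
  Nat.le_antisymm (Nat.le_of_not_lt fun h' => lt_irrefl _ ((h _).1 h'))
    (Nat.le_of_not_lt fun h' => lt_irrefl _ ((h _).2 h'))

theorem rowLen_eq_zero_of_colLen_le {lam : YoungDiagram} {i : ℕ} (h : lam.colLen 0 ≤ i) :
    lam.rowLen i = 0 := by
  by_contra hne
  have h1 : (i, 0) ∈ lam := YoungDiagram.mem_iff_lt_rowLen.2 (Nat.pos_of_ne_zero hne)
  exact absurd (YoungDiagram.mem_iff_lt_colLen.1 h1) (Nat.not_lt.2 h)

theorem card_eq_sum_rowLen (lam : YoungDiagram) (N : ℕ) (hN : lam.colLen 0 ≤ N) :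
    lam.card = ∑ r ∈ Finset.range N, lam.rowLen r := by
  rw [YoungDiagram.card, Finset.card_eq_sum_card_fiberwise (f := Prod.fst) (t := Finset.range N)]
  · exact Finset.sum_congr rfl fun r _ => by rw [YoungDiagram.rowLen_eq_card]; rfl
  · intro c hc
    have h : (c.1, 0) ∈ lam := lam.up_left_mem le_rfl (Nat.zero_le _) hc
    exact Finset.mem_coe.2 (Finset.mem_range.2 ((YoungDiagram.mem_iff_lt_colLen.1 h).trans_le hN))

theorem prod_cells_eq_prod_rows {M : Type*} [CommMonoid M] (lam : YoungDiagram) (N : ℕ)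
    (hN : lam.colLen 0 ≤ N) (f : ℕ × ℕ → M) :
    ∏ v ∈ lam.cells, f v =
      ∏ r ∈ Finset.range N, ∏ j ∈ Finset.range (lam.rowLen r), f (r, j) := by
  rw [Finset.prod_sigma']
  refine Finset.prod_bij' (fun v _ => ⟨v.1, v.2⟩) (fun s _ => (s.1, s.2)) ?_ ?_ ?_ ?_ ?_
  · intro c hc
    have h : (c.1, 0) ∈ lam := lam.up_left_mem le_rfl (Nat.zero_le _) hc
    exact Finset.mem_sigma.2 ⟨Finset.mem_range.2
      ((YoungDiagram.mem_iff_lt_colLen.1 h).trans_le hN),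
      Finset.mem_range.2 (YoungDiagram.mem_iff_lt_rowLen.1 hc)⟩
  · intro s hs
    exact YoungDiagram.mem_iff_lt_rowLen.2 (Finset.mem_range.1 (Finset.mem_sigma.1 hs).2)
  · intros; rfl
  · intros; rfl
  · intros; rfl

theorem prod_Icc_one_id (n : ℕ) : ∏ i ∈ Finset.Icc 1 n, i = n.factorial := by
  induction n with
  | zero => rfl
  | succ n ih => rw [Finset.prod_Icc_succ_top (by omega), ih, Nat.factorial_succ, mul_comm]

/-- The hook lengths in row `r` and the differences `x r - x k`, `k > r`, of shifted row lengths
together are exactly `1, …, x r`. -/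
theorem prod_hookLength_row (lam : YoungDiagram) (N r : ℕ) (hN : lam.colLen 0 ≤ N) (hr : r < N) :
    (∏ j ∈ Finset.range (lam.rowLen r), hookLength lam (r, j)) *
      ∏ k ∈ Finset.Ioo r N, (lam.rowLen r + k - (lam.rowLen k + r)) =
      (lam.rowLen r + N - 1 - r).factorial := by
  have hcell : ∀ k j, (j < lam.rowLen k ∧ k < lam.colLen j) ∨
      (lam.rowLen k ≤ j ∧ lam.colLen j ≤ k) := by
    intro k j
    have := (YoungDiagram.mem_iff_lt_rowLen (μ := lam) (i := k) (j := j)).symm.trans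
      YoungDiagram.mem_iff_lt_colLen
    omega
  have hh : ∀ j, hookLength lam (r, j) =
      (lam.rowLen r - j - 1) + (lam.colLen j - r - 1) + 1 := fun j => rfl
  have hinj1 : Set.InjOn (fun j => hookLength lam (r, j)) (Finset.range (lam.rowLen r)) := by
    have key : ∀ i j, i < j → j < lam.rowLen r →
        hookLength lam (r, j) < hookLength lam (r, i) := by
      intro i j hij hj
      have h1 := lam.colLen_anti i j hij.le
      rw [hh, hh]
      omega
    intro i hi j hj hij
    simp only [Finset.coe_range, Set.mem_Iio] at hi hj
    by_contra hne
    rcases Nat.lt_or_gt_of_ne hne with h | h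
    · exact (key i j h hj).ne hij.symm
    · exact (key j i h hi).ne hij
  have hinj2 : Set.InjOn (fun k => lam.rowLen r + k - (lam.rowLen k + r)) (Finset.Ioo r N) := by
    have key : ∀ i k, r < i → i < k →
        lam.rowLen r + i - (lam.rowLen i + r) < lam.rowLen r + k - (lam.rowLen k + r) := by
      intro i k hi hik
      have h1 := lam.rowLen_anti i k hik.le
      have h2 := lam.rowLen_anti r i hi.le
      omega
    intro i hi j hj hij
    simp only [Finset.coe_Ioo, Set.mem_Ioo] at hi hj
    by_contra hne
    rcases Nat.lt_or_gt_of_ne hne with h | h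
    · exact (key i j hi.1 h).ne hij
    · exact (key j i hj.1 h).ne hij.symm
  have hdisj : Disjoint ((Finset.range (lam.rowLen r)).image fun j => hookLength lam (r, j))
      ((Finset.Ioo r N).image fun k => lam.rowLen r + k - (lam.rowLen k + r)) := by
    rw [Finset.disjoint_left]
    intro a ha hb
    obtain ⟨j, hj, rfl⟩ := Finset.mem_image.1 ha
    obtain ⟨k, hk, hkj⟩ := Finset.mem_image.1 hb
    rw [Finset.mem_range] at hj
    rw [Finset.mem_Ioo] at hk
    rw [hh] at hkj
    have h1 := hcell r j
    have h2 := lam.rowLen_anti r k hk.1.le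
    -- `(k, j)` lies either in the diagram or outside it; both exclude `λ'_j + λ_k = j + k + 1`.
    rcases hcell k j with h | h <;> omega
  have hunion : ((Finset.range (lam.rowLen r)).image fun j => hookLength lam (r, j)) ∪
      ((Finset.Ioo r N).image fun k => lam.rowLen r + k - (lam.rowLen k + r)) =
      Finset.Icc 1 (lam.rowLen r + N - 1 - r) := by
    apply Finset.eq_of_subset_of_card_le
    · intro a ha
      rw [Finset.mem_Icc]
      rcases Finset.mem_union.1 ha with ha | ha
      · obtain ⟨j, hj, rfl⟩ := Finset.mem_image.1 ha
        rw [Finset.mem_range] at hj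
        have h1 := (lam.colLen_anti 0 j (Nat.zero_le j)).trans hN
        rw [hh]
        omega
      · obtain ⟨k, hk, rfl⟩ := Finset.mem_image.1 ha
        rw [Finset.mem_Ioo] at hk
        have h2 := lam.rowLen_anti r k hk.1.le
        omega
    · rw [Finset.card_union_of_disjoint hdisj, Finset.card_image_of_injOn hinj1,
        Finset.card_image_of_injOn hinj2]
      simp
      omega
  rw [← prod_Icc_one_id, ← hunion, Finset.prod_union hdisj,
    Finset.prod_image hinj1, Finset.prod_image hinj2]

/-- The shifted row length `λ_r + N - 1 - r` (rows counted from `0`, among `N` of them). -/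
def shiftedRow (lam : YoungDiagram) (N r : ℕ) : ℚ :=
  (lam.rowLen r : ℚ) + N - 1 - r

/-- The Vandermonde product `∏_{i<k<N} (x i - x k)`. -/
def differenceProduct (N : ℕ) (x : ℕ → ℚ) : ℚ :=
  ∏ k ∈ Finset.range N, ∏ i ∈ Finset.range k, (x i - x k)

theorem shiftedRow_lt (lam : YoungDiagram) (N : ℕ) {i k : ℕ} (h : i < k) :
    shiftedRow lam N k < shiftedRow lam N i := by
  have h1 : (lam.rowLen k : ℚ) ≤ lam.rowLen i := by exact_mod_cast lam.rowLen_anti i k h.le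
  have h2 : (i : ℚ) < k := by exact_mod_cast h
  unfold shiftedRow
  linarith

theorem shiftedRow_injective (lam : YoungDiagram) (N : ℕ) :
    Function.Injective (shiftedRow lam N) :=
  (strictAnti_iff_forall_covBy (f := shiftedRow lam N) |>.2 fun _ _ h =>
    shiftedRow_lt lam N h.lt).injective

theorem differenceProduct_shiftedRow_ne_zero (lam : YoungDiagram) (N : ℕ) :
    differenceProduct N (shiftedRow lam N) ≠ 0 :=
  Finset.prod_ne_zero_iff.2 fun _ _ => Finset.prod_ne_zero_iff.2 fun _ hi =>
    sub_ne_zero.2 (shiftedRow_lt lam N (Finset.mem_range.1 hi)).ne'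

/-- The hook product in terms of the shifted row lengths: `H_λ = ∏ x_r! / ∏_{i<k} (x_i - x_k)`. -/
theorem hookProduct_mul_differenceProduct (lam : YoungDiagram) (N : ℕ) (hN : lam.colLen 0 ≤ N) :
    (hookProduct lam : ℚ) * differenceProduct N (shiftedRow lam N) =
      ∏ r ∈ Finset.range N, ((lam.rowLen r + N - 1 - r).factorial : ℚ) := by
  have hD : differenceProduct N (shiftedRow lam N) = ∏ r ∈ Finset.range N,
      ∏ k ∈ Finset.Ioo r N, ((lam.rowLen r + k - (lam.rowLen k + r) : ℕ) : ℚ) := by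
    rw [differenceProduct]
    rw [Finset.prod_comm' (t' := Finset.range N) (s' := fun r => Finset.Ioo r N)]
    · refine Finset.prod_congr rfl fun r _ => Finset.prod_congr rfl fun k hk => ?_
      have hk' := Finset.mem_Ioo.1 hk
      have := lam.rowLen_anti r k hk'.1.le
      rw [Nat.cast_sub (by omega)]
      unfold shiftedRow
      push_cast
      ring
    · intro a b
      simp only [Finset.mem_range, Finset.mem_Ioo]
      omega
  rw [hD, hookProduct, prod_cells_eq_prod_rows lam N hN, Nat.cast_prod, ← Finset.prod_mul_distrib]
  refine Finset.prod_congr rfl fun r hr => ?_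
  rw [← prod_hookLength_row lam N r hN (Finset.mem_range.1 hr)]
  push_cast
  rfl

theorem hookProduct_pos (lam : YoungDiagram) : 0 < hookProduct lam :=
  Finset.prod_pos fun _ _ => Nat.succ_pos _

/-! ### Removing a corner -/

/-- The corners of a Young diagram: the cells whose removal leaves a Young diagram. -/
def corners (lam : YoungDiagram) : Finset (ℕ × ℕ) :=
  lam.cells.filter fun c => (c.1 + 1, c.2) ∉ lam.cells ∧ (c.1, c.2 + 1) ∉ lam.cells

/-- The diagram `λ` without the cells weakly south-east of `c`; this removes just the cell `c`
when `c` is a corner. -/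
def removeCell (lam : YoungDiagram) (c : ℕ × ℕ) : YoungDiagram where
  cells := lam.cells.filter fun d => ¬ c ≤ d
  isLowerSet := by
    intro a b hba ha
    simp only [Finset.coe_filter, Set.mem_ofPred_eq] at ha ⊢
    exact ⟨lam.isLowerSet hba ha.1, fun h => ha.2 (h.trans hba)⟩

theorem mem_corners_iff {lam : YoungDiagram} {r j : ℕ} :
    (r, j) ∈ corners lam ↔ lam.rowLen r = j + 1 ∧ lam.rowLen (r + 1) ≤ j := by
  simp only [corners, Finset.mem_filter, YoungDiagram.mem_cells, YoungDiagram.mem_iff_lt_rowLen]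
  omega

theorem removeCell_cells {lam : YoungDiagram} {c : ℕ × ℕ} (hc : c ∈ corners lam) :
    (removeCell lam c).cells = lam.cells.erase c := by
  obtain ⟨r, j⟩ := c
  have hc' := mem_corners_iff.1 hc
  ext ⟨a, b⟩
  simp only [removeCell, Finset.mem_filter, Finset.mem_erase, YoungDiagram.mem_cells,
    YoungDiagram.mem_iff_lt_rowLen, Prod.mk_le_mk, ne_eq, Prod.mk.injEq]
  constructor
  · rintro ⟨h1, h2⟩
    exact ⟨fun h => h2 ⟨h.1.ge, h.2.ge⟩, h1⟩
  · rintro ⟨h1, h2⟩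
    refine ⟨h2, fun ⟨h3, h4⟩ => h1 ?_⟩
    rcases h3.lt_or_eq with h | rfl
    · have := lam.rowLen_anti (r + 1) a h
      omega
    · omega

theorem card_removeCell {lam : YoungDiagram} {c : ℕ × ℕ} (hc : c ∈ corners lam) :
    (removeCell lam c).card + 1 = lam.card := by
  rw [YoungDiagram.card, removeCell_cells hc]
  exact Finset.card_erase_add_one (Finset.mem_filter.1 hc).1

theorem rowLen_removeCell {lam : YoungDiagram} {c : ℕ × ℕ} (hc : c ∈ corners lam) (i : ℕ) :
    (removeCell lam c).rowLen i = if i = c.1 then lam.rowLen i - 1 else lam.rowLen i := by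
  obtain ⟨r, j⟩ := c
  have hc' := mem_corners_iff.1 hc
  refine eq_of_forall_lt_iff_lt fun b => ?_
  rw [← YoungDiagram.mem_iff_lt_rowLen, ← YoungDiagram.mem_cells, removeCell_cells hc,
    Finset.mem_erase, YoungDiagram.mem_cells, YoungDiagram.mem_iff_lt_rowLen, ne_eq,
    Prod.mk.injEq]
  split_ifs with h
  · subst h; omega
  · simp [h]

theorem colLen_removeCell_le (lam : YoungDiagram) (c : ℕ × ℕ) (j : ℕ) :
    (removeCell lam c).colLen j ≤ lam.colLen j := by
  by_contra! h
  rw [← YoungDiagram.mem_iff_lt_colLen] at h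
  exact lt_irrefl _ (YoungDiagram.mem_iff_lt_colLen.1 (Finset.mem_filter.1 h).1)

theorem shiftedRow_removeCell {lam : YoungDiagram} {c : ℕ × ℕ} (hc : c ∈ corners lam) (N i : ℕ) :
    shiftedRow (removeCell lam c) N i = shiftedRow lam N i - if i = c.1 then 1 else 0 := by
  unfold shiftedRow
  rw [rowLen_removeCell hc]
  split_ifs with h
  · have := (mem_corners_iff.1 hc).1
    rw [← h] at this
    rw [Nat.cast_sub (by omega), Nat.cast_one]
    ring
  · ring

/-- Lowering `x r` by one multiplies the Vandermonde product by the factors of the pairs that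
contain `r`. -/
theorem differenceProduct_sub_single (N : ℕ) (x : ℕ → ℚ) (hx : Function.Injective x) {r : ℕ}
    (hr : r < N) :
    differenceProduct N (fun i => x i - if i = r then 1 else 0) =
      differenceProduct N x *
        ∏ j ∈ (Finset.range N).erase r, ((x r - 1 - x j) / (x r - x j)) := by
  set g : ℕ → ℚ := fun j => (x r - 1 - x j) / (x r - x j) with hg
  have hsub : ∀ i k, i ≠ k → x i - x k ≠ 0 := fun i k h => sub_ne_zero.2 (hx.ne h)
  have hfac : ∀ k, ∀ i ∈ Finset.range k,
      ((x i - if i = r then 1 else 0) - (x k - if k = r then 1 else 0)) =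
      (x i - x k) * ((if k = r then g i else 1) * (if i = r then g k else 1)) := by
    intro k i hi
    have hik : i ≠ k := (Finset.mem_range.1 hi).ne
    have h0 := hsub i k hik
    by_cases hk : k = r
    · subst hk
      have h1 := hsub k i hik.symm
      simp only [hik, if_true, if_false, hg]
      field_simp
      ring
    · by_cases hi : i = r
      · subst hi
        simp only [hk, if_true, if_false, hg]
        field_simp
        ring
      · simp [hk, hi]
  have hsplit : (Finset.range N).erase r = Finset.range r ∪ Finset.Ioo r N := by
    ext a
    simp only [Finset.mem_erase, Finset.mem_range, Finset.mem_union, Finset.mem_Ioo]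
    omega
  have hdisj : Disjoint (Finset.range r) (Finset.Ioo r N) := by
    rw [Finset.disjoint_left]
    intro a ha hb
    rw [Finset.mem_range] at ha
    rw [Finset.mem_Ioo] at hb
    omega
  rw [differenceProduct, Finset.prod_congr rfl fun k _ => Finset.prod_congr rfl (hfac k)]
  simp only [Finset.prod_mul_distrib]
  rw [← differenceProduct, hsplit, Finset.prod_union hdisj]
  congr 2
  · rw [Finset.prod_eq_single r]
    · exact Finset.prod_congr rfl fun i _ => if_pos rfl
    · intro k _ hk
      simp [hk]
    · intro h
      exact absurd (Finset.mem_range.2 hr) h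
  · have : ∀ k ∈ Finset.range N, (∏ i ∈ Finset.range k, if i = r then g k else 1) =
        if r < k then g k else 1 := by
      intro k _
      rw [Finset.prod_ite_eq']
      simp
    rw [Finset.prod_congr rfl this, ← Finset.prod_filter]
    congr 1
    ext a
    simp [and_comm]

/-- The weight of the row of a corner `c` is `H_λ / H_{λ∖c}`. -/
theorem cornerWeight_mul_hookProduct {lam : YoungDiagram} {c : ℕ × ℕ} (hc : c ∈ corners lam)
    (N : ℕ) (hN : lam.colLen 0 ≤ N) :
    cornerWeight (Finset.range N) (shiftedRow lam N) c.1 * hookProduct (removeCell lam c) =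
      hookProduct lam := by
  have hrow := (mem_corners_iff (r := c.1) (j := c.2)).1 hc
  have hr : c.1 < N := by
    have h : (c.1, 0) ∈ lam := YoungDiagram.mem_iff_lt_rowLen.2 (by omega)
    exact (YoungDiagram.mem_iff_lt_colLen.1 h).trans_le hN
  have h1 := hookProduct_mul_differenceProduct lam N hN
  have h2 := hookProduct_mul_differenceProduct (removeCell lam c) N
    ((colLen_removeCell_le lam c 0).trans hN)
  have hx : shiftedRow (removeCell lam c) N =
      fun i => shiftedRow lam N i - if i = c.1 then 1 else 0 :=
    funext (shiftedRow_removeCell hc N)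
  rw [hx, differenceProduct_sub_single N _ (shiftedRow_injective lam N) hr] at h2
  have h3 : (∏ r ∈ Finset.range N, ((lam.rowLen r + N - 1 - r).factorial : ℚ)) =
      shiftedRow lam N c.1 * ∏ r ∈ Finset.range N,
        (((removeCell lam c).rowLen r + N - 1 - r).factorial : ℚ) := by
    have hmem := Finset.mem_range.2 hr
    rw [← Finset.mul_prod_erase _ _ hmem, ← Finset.mul_prod_erase (Finset.range N)
      (fun r => (((removeCell lam c).rowLen r + N - 1 - r).factorial : ℚ)) hmem, ← mul_assoc]
    congr 1
    · rw [rowLen_removeCell hc, if_pos rfl, shiftedRow, hrow.1]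
      obtain ⟨m, hm⟩ : ∃ m, c.2 + 1 + N - 1 - c.1 = m + 1 := ⟨c.2 + N - 1 - c.1, by omega⟩
      rw [hm, show c.2 + 1 - 1 + N - 1 - c.1 = m by omega, Nat.factorial_succ]
      have : (c.2 : ℚ) + N = m + 1 + c.1 := by exact_mod_cast (by omega : c.2 + N = m + 1 + c.1)
      push_cast
      linear_combination -(m.factorial : ℚ) * this
    · refine Finset.prod_congr rfl fun i hi => ?_
      rw [rowLen_removeCell hc, if_neg (Finset.ne_of_mem_erase hi)]
  refine mul_right_cancel₀ (differenceProduct_shiftedRow_ne_zero lam N) ?_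
  rw [h1, h3, ← h2, cornerWeight]
  ring

/-- Rows without a corner have weight zero, so sums over corners extend to all rows. -/
theorem cornerWeight_eq_zero (lam : YoungDiagram) (N r : ℕ) (hN : lam.colLen 0 ≤ N) (hr : r < N)
    (h : lam.rowLen (r + 1) = lam.rowLen r) :
    cornerWeight (Finset.range N) (shiftedRow lam N) r = 0 := by
  unfold cornerWeight
  rcases Nat.lt_or_ge (r + 1) N with h1 | h1
  · refine mul_eq_zero_of_right _ (Finset.prod_eq_zero (i := r + 1) (by simp [h1]) ?_)
    unfold shiftedRow
    rw [h]
    push_cast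
    ring
  · have h0 : lam.rowLen (r + 1) = 0 := rowLen_eq_zero_of_colLen_le (hN.trans h1)
    have hN' : N = r + 1 := by omega
    apply mul_eq_zero_of_left
    rw [shiftedRow, ← h, h0, hN']
    push_cast
    ring

/-- Each row contains at most one corner. A sum over rows of terms vanishing at the rows without a
corner is a sum over the corners. -/
theorem sum_range_eq_sum_corners (lam : YoungDiagram) (N : ℕ) (hN : lam.colLen 0 ≤ N)
    (F : ℕ → ℚ) (hF : ∀ r < N, lam.rowLen (r + 1) = lam.rowLen r → F r = 0) :
    ∑ r ∈ Finset.range N, F r = ∑ c ∈ corners lam, F c.1 := by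
  symm
  refine Finset.sum_bij_ne_zero (fun c _ _ => c.1) ?_ ?_ ?_ ?_
  · intro c hc _
    have h : (c.1, 0) ∈ lam := lam.up_left_mem le_rfl (Nat.zero_le _) (Finset.mem_filter.1 hc).1
    exact Finset.mem_range.2 ((YoungDiagram.mem_iff_lt_colLen.1 h).trans_le hN)
  · intro c hc _ d hd _ hcd
    have h1 := (mem_corners_iff (r := c.1) (j := c.2)).1 hc
    have h2 := (mem_corners_iff (r := d.1) (j := d.2)).1 hd
    rw [hcd] at h1
    exact Prod.ext hcd (by omega)
  · intro r hr hne
    have h1 := lam.rowLen_anti r (r + 1) (Nat.le_succ r)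
    have h2 : lam.rowLen (r + 1) ≠ lam.rowLen r :=
      fun h => hne (hF r (Finset.mem_range.1 hr) h)
    exact ⟨(r, lam.rowLen r - 1), mem_corners_iff.2 ⟨by omega, by omega⟩, hne, rfl⟩
  · intros; rfl

/-! ### Counting standard fillings -/

/-- The cell `d` lies to the right of `c` in the same row, or below `c` in the same column. -/
def Precedes (c d : ℕ × ℕ) : Prop :=
  (c.1 = d.1 ∧ c.2 < d.2) ∨ (c.2 = d.2 ∧ c.1 < d.1)

/-- Standard fillings of a finite set of cells by numbers below `N`, as functions on all cells
vanishing outside `S`; there is then no dependence of types on `S`. -/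
def fillings (S : Finset (ℕ × ℕ)) (N : ℕ) : Set (ℕ × ℕ → ℕ) :=
  {g | (∀ c, c ∉ S → g c = 0) ∧ (∀ c ∈ S, g c < N) ∧ Set.InjOn g S ∧
    ∀ c ∈ S, ∀ d ∈ S, Precedes c d → g c < g d}

/-- Fillings as functions on all cells correspond to fillings as bijections. -/
noncomputable def fillingsEquiv (S : Finset (ℕ × ℕ)) (N : ℕ) (hS : S.card = N) :
    fillings S N ≃ {T : {c // c ∈ S} ≃ Fin N //
      (∀ c d, c.1.1 = d.1.1 → c.1.2 < d.1.2 → T c < T d) ∧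
        (∀ c d, c.1.2 = d.1.2 → c.1.1 < d.1.1 → T c < T d)} where
  toFun g := ⟨Equiv.ofBijective (fun c => ⟨g.1 c.1, g.2.2.1 c.1 c.2⟩)
      ((Fintype.bijective_iff_injective_and_card _).2
        ⟨fun c d h => Subtype.ext (g.2.2.2.1 c.2 d.2 (Fin.mk.inj_iff.1 h)), by simp [hS]⟩),
    fun c d h1 h2 => g.2.2.2.2 c.1 c.2 d.1 d.2 (Or.inl ⟨h1, h2⟩),
    fun c d h1 h2 => g.2.2.2.2 c.1 c.2 d.1 d.2 (Or.inr ⟨h1, h2⟩)⟩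
  invFun T := ⟨fun c => if h : c ∈ S then T.1 ⟨c, h⟩ else 0,
    fun c hc => dif_neg hc,
    fun c hc => by simp only [hc, dif_pos]; exact (T.1 ⟨c, hc⟩).2,
    fun c hc d hd h => by
      have hc' : c ∈ S := hc
      have hd' : d ∈ S := hd
      simp only [hc', hd', dif_pos] at h
      exact congrArg Subtype.val (T.1.injective (Fin.ext h)),
    fun c hc d hd h => by
      simp only [hc, hd, dif_pos]
      rcases h with h | h
      · exact T.2.1 ⟨c, hc⟩ ⟨d, hd⟩ h.1 h.2
      · exact T.2.2 ⟨c, hc⟩ ⟨d, hd⟩ h.1 h.2⟩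
  left_inv g := by
    ext c
    by_cases hc : c ∈ S
    · simp [hc]
    · simp [hc, g.2.1 c hc]
  right_inv T := by
    ext c
    simp

theorem finite_fillings (S : Finset (ℕ × ℕ)) (N : ℕ) (hS : S.card = N) : (fillings S N).Finite :=
  have := Finite.of_equiv _ (fillingsEquiv S N hS).symm
  Set.toFinite _

theorem skewSYTCount_eq_ncard {lam kap : YoungDiagram} (h : kap ≤ lam) :
    skewSYTCount lam kap =
      (fillings (lam.cells \ kap.cells) (lam.cells \ kap.cells).card).ncard := by
  rw [skewSYTCount, if_pos h]
  exact (Nat.card_congr (fillingsEquiv _ _ rfl)).symm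

open Classical in
/-- The largest entry of a standard filling sits in a cell preceding no other one, and removing it
leaves a standard filling. -/
theorem ncard_fillings_succ (S : Finset (ℕ × ℕ)) (N : ℕ) (hS : S.card = N + 1) :
    (fillings S (N + 1)).ncard =
      ∑ c ∈ S with ∀ d ∈ S, ¬ Precedes c d, (fillings (S.erase c) N).ncard := by
  have hirr : ∀ c, ¬ Precedes c c := fun c h => by
    rcases h with h | h <;> exact lt_irrefl _ h.2
  set t : Finset (ℕ × ℕ) := S.filter fun c => ∀ d ∈ S, ¬ Precedes c d with ht
  have hfib : ∀ c ∈ t, {g ∈ fillings S (N + 1) | g c = N} =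
      (fun h => Function.update h c N) '' fillings (S.erase c) N := by
    intro c hc
    obtain ⟨hcS, hmax⟩ := Finset.mem_filter.1 hc
    ext g
    constructor
    · rintro ⟨⟨h0, hlt, hinj, hinc⟩, hgc⟩
      refine ⟨Function.update g c 0, ⟨?_, ?_, ?_, ?_⟩, ?_⟩
      · intro d hd
        by_cases hdc : d = c
        · simp [hdc]
        · rw [Function.update_of_ne hdc]
          exact h0 d fun h => hd (Finset.mem_erase.2 ⟨hdc, h⟩)
      · intro d hd
        obtain ⟨hdc, hdS⟩ := Finset.mem_erase.1 hd
        rw [Function.update_of_ne hdc]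
        have h1 := hlt d hdS
        have h2 : g d ≠ g c := fun h => hdc (hinj hdS hcS h)
        omega
      · intro d hd e he hde
        obtain ⟨hdc, hdS⟩ := Finset.mem_erase.1 (Finset.mem_coe.1 hd)
        obtain ⟨hec, heS⟩ := Finset.mem_erase.1 (Finset.mem_coe.1 he)
        rw [Function.update_of_ne hdc, Function.update_of_ne hec] at hde
        exact hinj hdS heS hde
      · intro d hd e he hde
        obtain ⟨hdc, hdS⟩ := Finset.mem_erase.1 hd
        obtain ⟨hec, heS⟩ := Finset.mem_erase.1 he
        rw [Function.update_of_ne hdc, Function.update_of_ne hec]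
        exact hinc d hdS e heS hde
      · simp [← hgc]
    · rintro ⟨h, ⟨h0, hlt, hinj, hinc⟩, rfl⟩
      have hlt' : ∀ d ∈ S, d ≠ c → h d < N := fun d hd hdc =>
        hlt d (Finset.mem_erase.2 ⟨hdc, hd⟩)
      refine ⟨⟨?_, ?_, ?_, ?_⟩, by simp⟩
      · intro d hd
        have hdc : d ≠ c := fun h => hd (h ▸ hcS)
        simp only [Function.update_of_ne hdc]
        exact h0 d fun h => hd (Finset.mem_of_mem_erase h)
      · intro d hd
        by_cases hdc : d = c
        · simp [hdc]
        · simp only [Function.update_of_ne hdc]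
          exact (hlt' d hd hdc).trans (Nat.lt_succ_self N)
      · intro d hd e he hde
        have hd : d ∈ S := hd
        have he : e ∈ S := he
        by_cases hdc : d = c <;> by_cases hec : e = c
        · rw [hdc, hec]
        · simp only [hdc, Function.update_self, Function.update_of_ne hec] at hde
          exact absurd hde (hlt' e he hec).ne'
        · simp only [hec, Function.update_self, Function.update_of_ne hdc] at hde
          exact absurd hde (hlt' d hd hdc).ne
        · simp only [Function.update_of_ne hec, Function.update_of_ne hdc] at hde
          exact hinj (Finset.mem_coe.2 (Finset.mem_erase.2 ⟨hdc, hd⟩))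
            (Finset.mem_coe.2 (Finset.mem_erase.2 ⟨hec, he⟩)) hde
      · intro d hd e he hde
        have hdc : d ≠ c := fun h => hmax e he (h ▸ hde)
        simp only [Function.update_of_ne hdc]
        by_cases hec : e = c
        · rw [hec, Function.update_self]
          exact hlt' d hd hdc
        · rw [Function.update_of_ne hec]
          exact hinc d (Finset.mem_erase.2 ⟨hdc, hd⟩) e (Finset.mem_erase.2 ⟨hec, he⟩) hde
  have hunion : fillings S (N + 1) =
      ⋃ c ∈ (t : Set (ℕ × ℕ)), {g ∈ fillings S (N + 1) | g c = N} := by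
    ext g
    simp only [Set.mem_iUnion, exists_prop]
    refine ⟨fun hg => ?_, fun ⟨_, _, hg, _⟩ => hg⟩
    obtain ⟨h0, hlt, hinj, hinc⟩ := hg
    -- An injective filling by `N + 1` numbers uses `N`.
    have himg : S.image g = Finset.range (N + 1) := by
      apply Finset.eq_of_subset_of_card_le
      · intro a ha
        obtain ⟨c, hc, rfl⟩ := Finset.mem_image.1 ha
        exact Finset.mem_range.2 (hlt c hc)
      · rw [Finset.card_image_of_injOn hinj, hS, Finset.card_range]
    have hN : N ∈ S.image g := by rw [himg]; simp
    obtain ⟨c, hc, hgc⟩ := Finset.mem_image.1 hN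
    refine ⟨c, Finset.mem_coe.2 (Finset.mem_filter.2 ⟨hc, fun d hd hcd => ?_⟩),
      ⟨h0, hlt, hinj, hinc⟩, hgc⟩
    have h1 := hinc c hc d hd hcd
    have h2 := hlt d hd
    omega
  have hdisj : (t : Set (ℕ × ℕ)).PairwiseDisjoint
      fun c => {g ∈ fillings S (N + 1) | g c = N} := by
    intro c hc d hd hcd
    refine Set.disjoint_left.2 fun g hg1 hg2 => hcd ?_
    exact hg1.1.2.2.1 (Finset.mem_filter.1 hc).1 (Finset.mem_filter.1 hd).1
      (hg1.2.trans hg2.2.symm)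
  rw [hunion, Set.Finite.ncard_biUnion t.finite_toSet
    (fun c _ => (finite_fillings S (N + 1) hS).subset fun g hg => hg.1) hdisj,
    finsum_mem_coe_finset]
  refine Finset.sum_congr rfl fun c hc => ?_
  rw [hfib c hc]
  refine Set.InjOn.ncard_image fun g hg h hh hgh => funext fun d => ?_
  by_cases hdc : d = c
  · rw [hdc, hg.1 c (Finset.notMem_erase c S), hh.1 c (Finset.notMem_erase c S)]
  · have := congrFun hgh d
    simpa [hdc] using this

theorem removeCell_le (lam : YoungDiagram) (c : ℕ × ℕ) : removeCell lam c ≤ lam :=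
  YoungDiagram.cells_subset_iff.1 (Finset.filter_subset _ _)

theorem le_removeCell_iff {lam kap : YoungDiagram} (h : kap ≤ lam) {c : ℕ × ℕ}
    (hc : c ∈ corners lam) : kap ≤ removeCell lam c ↔ c ∉ kap.cells := by
  rw [← YoungDiagram.cells_subset_iff, removeCell_cells hc, Finset.subset_erase]
  exact and_iff_right (YoungDiagram.cells_subset_iff.2 h)

open Classical in
theorem filter_not_precedes_sdiff (lam kap : YoungDiagram) :
    ((lam.cells \ kap.cells).filter fun c => ∀ d ∈ lam.cells \ kap.cells, ¬ Precedes c d) =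
      (corners lam).filter fun c => c ∉ kap.cells := by
  ext ⟨r, j⟩
  simp only [Finset.mem_filter, Finset.mem_sdiff, corners]
  constructor
  · rintro ⟨⟨h1, h2⟩, h3⟩
    refine ⟨⟨h1, fun h => ?_, fun h => ?_⟩, h2⟩
    · exact h3 _ ⟨h, fun h' => h2 (kap.up_left_mem (Nat.le_succ r) le_rfl h')⟩
        (Or.inr ⟨rfl, Nat.lt_succ_self r⟩)
    · exact h3 _ ⟨h, fun h' => h2 (kap.up_left_mem le_rfl (Nat.le_succ j) h')⟩
        (Or.inl ⟨rfl, Nat.lt_succ_self j⟩)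
  · rintro ⟨⟨h1, h3, h4⟩, h2⟩
    refine ⟨⟨h1, h2⟩, ?_⟩
    rintro ⟨a, b⟩ ⟨hd, -⟩ (⟨h5, h6⟩ | ⟨h5, h6⟩)
    · simp only at h5 h6
      subst h5
      exact h4 (lam.up_left_mem le_rfl h6 hd)
    · simp only at h5 h6
      subst h5
      exact h3 (lam.up_left_mem h6 le_rfl hd)

theorem skewSYTCount_self (lam : YoungDiagram) : skewSYTCount lam lam = 1 := by
  rw [skewSYTCount_eq_ncard le_rfl, Set.ncard_eq_one]
  refine ⟨fun _ => 0, ?_⟩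
  ext g
  simp [fillings, funext_iff]

theorem skewSYTCount_of_not_le {lam kap : YoungDiagram} (h : ¬ kap ≤ lam) :
    skewSYTCount lam kap = 0 := if_neg h

/-- The branching rule for skew standard Young tableaux. -/
theorem skewSYTCount_eq_sum_corners {lam kap : YoungDiagram} (hne : kap ≠ lam) :
    skewSYTCount lam kap = ∑ c ∈ corners lam, skewSYTCount (removeCell lam c) kap := by
  classical
  by_cases h : kap ≤ lam
  · have hpos : 0 < (lam.cells \ kap.cells).card := by
      rw [Finset.card_pos, Finset.sdiff_nonempty]
      exact fun h' => hne (le_antisymm h (YoungDiagram.cells_subset_iff.1 h'))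
    obtain ⟨N, hN⟩ := Nat.exists_eq_add_of_le' hpos
    rw [skewSYTCount_eq_ncard h, hN, ncard_fillings_succ _ N hN, filter_not_precedes_sdiff,
      Finset.sum_filter]
    refine Finset.sum_congr rfl fun c hc => ?_
    have hle := le_removeCell_iff h hc
    by_cases hck : c ∉ kap.cells
    · rw [if_pos hck]
      have hS : (removeCell lam c).cells \ kap.cells = (lam.cells \ kap.cells).erase c := by
        rw [removeCell_cells hc, Finset.erase_sdiff_comm]
      have hcS : c ∈ lam.cells \ kap.cells :=
        Finset.mem_sdiff.2 ⟨(Finset.mem_filter.1 hc).1, hck⟩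
      rw [skewSYTCount_eq_ncard (hle.2 hck), hS, Finset.card_erase_of_mem hcS, hN,
        Nat.add_sub_cancel]
    · rw [if_neg hck]
      exact (skewSYTCount_of_not_le fun h' => hck (hle.1 h')).symm
  · rw [skewSYTCount_of_not_le h]
    exact (Finset.sum_eq_zero fun c _ =>
      skewSYTCount_of_not_le fun h' => h (h'.trans (removeCell_le lam c))).symm

/-! ### The stacked diagrams -/

theorem hookProduct_transpose (lam : YoungDiagram) :
    hookProduct lam.transpose = hookProduct lam := by
  refine Finset.prod_bij' (fun c _ => c.swap) (fun c _ => c.swap) ?_ ?_ ?_ ?_ ?_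
  · intro c hc
    exact YoungDiagram.mem_transpose.1 hc
  · intro c hc
    exact YoungDiagram.mem_transpose.2 (by simpa using hc)
  · intros; rfl
  · intros; rfl
  · intro c _
    simp only [hookLength, YoungDiagram.rowLen_transpose, YoungDiagram.colLen_transpose,
      Prod.fst_swap, Prod.snd_swap]
    omega

theorem rowLen_le_card (lam : YoungDiagram) (i : ℕ) : lam.rowLen i ≤ lam.card := by
  rw [YoungDiagram.rowLen_eq_card]
  exact Finset.card_le_card (Finset.filter_subset _ _)

theorem mem_stackedDiagram {u : ℕ} {lam : YoungDiagram} {i j : ℕ} :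
    (i, j) ∈ stackedDiagram u lam ↔
      (i < u ∧ j < lam.card) ∨ (u ≤ i ∧ j < lam.colLen (i - u)) := by
  rw [stackedDiagram, YoungDiagram.mem_ofRowLens]
  simp only [List.length_append, List.length_replicate, List.length_map, List.length_range,
    List.getElem_append, List.getElem_replicate, List.getElem_map, List.getElem_range]
  rcases Nat.lt_or_ge i u with h | h
  · simp only [h, dif_pos]
    constructor
    · rintro ⟨_, h2⟩
      exact Or.inl ⟨trivial, h2⟩
    · rintro (⟨_, h2⟩ | ⟨h2, _⟩)
      · exact ⟨by omega, h2⟩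
      · omega
  · have h' : ¬ i < u := by omega
    simp only [h', dif_neg, not_false_eq_true]
    constructor
    · rintro ⟨_, h2⟩
      exact Or.inr ⟨h, h2⟩
    · rintro (⟨h2, _⟩ | ⟨_, h2⟩)
      · exact h2.elim
      · have h3 : (0, i - u) ∈ lam := YoungDiagram.mem_iff_lt_colLen.2 (by omega)
        have h4 := YoungDiagram.mem_iff_lt_rowLen.1 h3
        have h5 := rowLen_le_card lam 0
        exact ⟨by omega, h2⟩

theorem rowLen_stackedDiagram (u : ℕ) (lam : YoungDiagram) (i : ℕ) :
    (stackedDiagram u lam).rowLen i = if i < u then lam.card else lam.colLen (i - u) := by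
  refine eq_of_forall_lt_iff_lt fun j => ?_
  rw [← YoungDiagram.mem_iff_lt_rowLen, mem_stackedDiagram]
  split_ifs <;> omega

theorem colLen_stackedDiagram (u : ℕ) (lam : YoungDiagram) {j : ℕ} (hj : j < lam.card) :
    (stackedDiagram u lam).colLen j = u + lam.rowLen j := by
  refine eq_of_forall_lt_iff_lt fun i => ?_
  rw [← YoungDiagram.mem_iff_lt_colLen, mem_stackedDiagram, ← YoungDiagram.mem_iff_lt_colLen,
    YoungDiagram.mem_iff_lt_rowLen (μ := lam)]
  omega

theorem stackedDiagram_zero (lam : YoungDiagram) : stackedDiagram 0 lam = lam.transpose := by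
  refine SetLike.ext fun ⟨i, j⟩ => ?_
  rw [mem_stackedDiagram, YoungDiagram.mem_iff_lt_rowLen, YoungDiagram.rowLen_transpose]
  simp

theorem prod_row_zero_stackedDiagram (u : ℕ) (lam : YoungDiagram) :
    ∏ v ∈ (stackedDiagram (u + 1) lam).row 0, hookLength (stackedDiagram (u + 1) lam) v =
      ∏ j ∈ Finset.range lam.card, hookLength (stackedDiagram (u + 1) lam) (0, j) := by
  rw [YoungDiagram.row_eq_prod, Finset.prod_product, Finset.prod_singleton, rowLen_stackedDiagram,
    if_pos (Nat.succ_pos u)]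

theorem shiftedPartsProduct_eq (lam : YoungDiagram) (x : ℚ) :
    shiftedPartsProduct lam x =
      ∏ j ∈ Finset.range lam.card, ((lam.rowLen j : ℚ) + lam.card - (j + 1) + x) := by
  refine Finset.prod_bij' (fun i _ => i - 1) (fun j _ => j + 1) ?_ ?_ ?_ ?_ ?_
  · intro i hi
    have := Finset.mem_Icc.1 hi
    exact Finset.mem_range.2 (by omega)
  · intro j hj
    have := Finset.mem_range.1 hj
    exact Finset.mem_Icc.2 (by omega)
  · intro i hi
    have := Finset.mem_Icc.1 hi
    omega
  · intros; rfl
  · intro i hi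
    rw [Nat.cast_sub (Finset.mem_Icc.1 hi).1]
    push_cast
    ring

/-- The hook lengths in the top row of the stacked diagram are the factors of `φ_λ`. -/
theorem shiftedPartsProduct_eq_prod_row (u : ℕ) (lam : YoungDiagram) :
    shiftedPartsProduct lam ((u + 1 : ℕ) : ℚ) =
      ∏ v ∈ (stackedDiagram (u + 1) lam).row 0,
        (hookLength (stackedDiagram (u + 1) lam) v : ℚ) := by
  rw [← Nat.cast_prod, prod_row_zero_stackedDiagram, shiftedPartsProduct_eq, Nat.cast_prod]
  refine Finset.prod_congr rfl fun j hj => ?_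
  have hj' := Finset.mem_range.1 hj
  rw [hookLength, rowLen_stackedDiagram, if_pos (Nat.succ_pos u), colLen_stackedDiagram _ _ hj']
  have h : lam.card - j - 1 + (u + 1 + lam.rowLen j - 0 - 1) + 1 + (j + 1) =
      lam.rowLen j + lam.card + (u + 1) := by omega
  have h' : ((lam.card - j - 1 + (u + 1 + lam.rowLen j - 0 - 1) + 1 : ℕ) : ℚ) + (j + 1) =
      lam.rowLen j + lam.card + (u + 1) := by exact_mod_cast h
  rw [eq_sub_of_add_eq h']
  push_cast
  ring

/-- Deleting the top row of a stacked diagram does not change the other hook lengths. -/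
theorem hookProduct_stackedDiagram_succ (u : ℕ) (lam : YoungDiagram) :
    hookProduct (stackedDiagram (u + 1) lam) =
      (∏ v ∈ (stackedDiagram (u + 1) lam).row 0, hookLength (stackedDiagram (u + 1) lam) v) *
        hookProduct (stackedDiagram u lam) := by
  have hrow : ∀ i, (stackedDiagram (u + 1) lam).rowLen (i + 1) = (stackedDiagram u lam).rowLen i :=
    fun i => by
      rw [rowLen_stackedDiagram, rowLen_stackedDiagram, Nat.add_sub_add_right]
      simp only [Nat.add_lt_add_iff_right]
  have hlt : ∀ i j, j < (stackedDiagram u lam).rowLen i → j < lam.card := fun i j h => by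
    rw [rowLen_stackedDiagram] at h
    have := colLen_le_card lam (i - u)
    split_ifs at h <;> omega
  set K := (stackedDiagram u lam).colLen 0 + (stackedDiagram (u + 1) lam).colLen 0 with hK
  rw [hookProduct, prod_cells_eq_prod_rows _ (K + 1) (by omega), Finset.prod_range_succ', mul_comm,
    prod_row_zero_stackedDiagram, rowLen_stackedDiagram, if_pos (Nat.succ_pos u), hookProduct,
    prod_cells_eq_prod_rows (stackedDiagram u lam) K (by omega)]
  congr 1
  refine Finset.prod_congr rfl fun i _ => ?_
  rw [hrow]
  refine Finset.prod_congr rfl fun j hj => ?_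
  have hj' := hlt i j (Finset.mem_range.1 hj)
  simp only [hookLength, hrow, colLen_stackedDiagram _ _ hj']
  omega

/-! ### Columns -/

theorem mem_columnDiagram {n i j : ℕ} : (i, j) ∈ columnDiagram n ↔ i < n ∧ j = 0 := by
  rw [columnDiagram, YoungDiagram.mem_ofRowLens]
  simp

theorem rowLen_columnDiagram (n i : ℕ) : (columnDiagram n).rowLen i = if i < n then 1 else 0 := by
  refine eq_of_forall_lt_iff_lt fun j => ?_
  rw [← YoungDiagram.mem_iff_lt_rowLen, mem_columnDiagram]
  split_ifs <;> omega

theorem colLen_columnDiagram_zero (n : ℕ) : (columnDiagram n).colLen 0 = n := by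
  refine eq_of_forall_lt_iff_lt fun j => ?_
  rw [← YoungDiagram.mem_iff_lt_colLen, mem_columnDiagram]
  omega

theorem card_columnDiagram (n : ℕ) : (columnDiagram n).card = n := by
  rw [card_eq_sum_rowLen _ n (colLen_columnDiagram_zero n).le]
  simp only [rowLen_columnDiagram]
  rw [Finset.sum_congr rfl fun i hi => if_pos (Finset.mem_range.1 hi)]
  simp

theorem eq_columnDiagram_of_le {n : ℕ} {lam : YoungDiagram} (hcard : lam.card = n)
    (h : columnDiagram n ≤ lam) : columnDiagram n = lam := by
  refine YoungDiagram.ext (Finset.eq_of_subset_of_card_le (YoungDiagram.cells_subset_iff.2 h) ?_)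
  exact (hcard.trans (card_columnDiagram n).symm).le

theorem colLen_zero_lt_of_ne_columnDiagram {n : ℕ} {lam : YoungDiagram} (hcard : lam.card = n)
    (h : columnDiagram n ≠ lam) : lam.colLen 0 < n := by
  by_contra! h'
  refine h (eq_columnDiagram_of_le hcard ?_)
  rintro ⟨i, j⟩ hij
  obtain ⟨h1, h2⟩ := mem_columnDiagram.1 hij
  rw [h2]
  exact YoungDiagram.mem_iff_lt_colLen.2 (h1.trans_le h')

theorem hookProduct_columnDiagram (n : ℕ) : hookProduct (columnDiagram n) = n.factorial := by
  rw [hookProduct, prod_cells_eq_prod_rows _ n (colLen_columnDiagram_zero n).le,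
    ← Finset.prod_range_add_one_eq_factorial, ← Finset.prod_range_reflect]
  refine Finset.prod_congr rfl fun i hi => ?_
  have hi' := Finset.mem_range.1 hi
  have hi'' : n - 1 - i < n := by omega
  rw [rowLen_columnDiagram, if_pos hi'', Finset.prod_range_one, hookLength, rowLen_columnDiagram,
    if_pos hi'', colLen_columnDiagram_zero]
  omega

theorem shiftedHookQuotient_columnDiagram (n : ℕ) (u : ℚ) :
    shiftedHookQuotient (columnDiagram n) u =
      (∏ i ∈ Finset.range n, (u + (i + 1))) / n.factorial := by
  rw [shiftedHookQuotient, hookProduct_columnDiagram, shiftedPartsProduct_eq, card_columnDiagram,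
    ← Finset.prod_range_reflect]
  congr 1
  refine Finset.prod_congr rfl fun i hi => ?_
  have hi' := Finset.mem_range.1 hi
  rw [rowLen_columnDiagram, if_pos (by omega), Nat.cast_sub (by omega), Nat.cast_sub (by omega)]
  push_cast
  ring

theorem corners_columnDiagram (n : ℕ) : corners (columnDiagram (n + 1)) = {(n, 0)} := by
  ext ⟨i, j⟩
  rw [mem_corners_iff, Finset.mem_singleton, rowLen_columnDiagram, rowLen_columnDiagram,
    Prod.mk.injEq]
  split_ifs <;> first | omega | (simp only [false_and, false_iff]; omega)

theorem removeCell_columnDiagram (n : ℕ) :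
    removeCell (columnDiagram (n + 1)) (n, 0) = columnDiagram n := by
  refine SetLike.ext fun ⟨i, j⟩ => ?_
  rw [YoungDiagram.mem_iff_lt_rowLen, YoungDiagram.mem_iff_lt_rowLen,
    rowLen_removeCell (by rw [corners_columnDiagram]; simp), rowLen_columnDiagram,
    rowLen_columnDiagram]
  simp only
  split_ifs <;> omega

/-! ### The difference equations -/

theorem sum_shiftedRow (lam : YoungDiagram) (N : ℕ) (hN : lam.colLen 0 ≤ N) :
    ∑ i ∈ Finset.range N, shiftedRow lam N i = lam.card + (N.choose 2 : ℚ) := by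
  have h : ∀ m : ℕ, ∑ i ∈ Finset.range m, ((m : ℚ) - 1 - i) = (m.choose 2 : ℚ) := by
    intro m
    induction m with
    | zero => simp
    | succ m ih =>
      have hc : (m + 1).choose 2 = m + m.choose 2 := by
        rw [Nat.choose_succ_succ' m 1, Nat.choose_one_right]
      rw [Finset.sum_range_succ', hc]
      push_cast
      rw [← ih]
      rw [add_comm]
      congr 1
      · ring
      · exact Finset.sum_congr rfl fun i _ => by ring
  rw [card_eq_sum_rowLen lam N hN, ← h N, Nat.cast_sum, ← Finset.sum_add_distrib]
  exact Finset.sum_congr rfl fun i _ => by unfold shiftedRow; ring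

/-- The difference equation for `A_λ`. -/
theorem shiftedHookQuotient_sub (lam : YoungDiagram) {M : ℕ} (hM : lam.card = M + 1) (u : ℚ) :
    shiftedHookQuotient lam u - shiftedHookQuotient lam (u - 1) =
      ∑ c ∈ corners lam, shiftedHookQuotient (removeCell lam c) u := by
  by_cases hcol : columnDiagram (M + 1) = lam
  · rw [← hcol, corners_columnDiagram, Finset.sum_singleton, removeCell_columnDiagram]
    simp only [shiftedHookQuotient_columnDiagram]
    have h1 : ∏ i ∈ Finset.range (M + 1), (u - 1 + ((i : ℚ) + 1)) =
        (∏ i ∈ Finset.range M, (u + ((i : ℚ) + 1))) * u := by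
      rw [Finset.prod_range_succ']
      congr 1
      · refine Finset.prod_congr rfl fun i _ => ?_
        push_cast
        ring
      · push_cast
        ring
    rw [h1, Finset.prod_range_succ, Nat.factorial_succ]
    have h2 : (M.factorial : ℚ) ≠ 0 := by exact_mod_cast M.factorial_ne_zero
    have h3 : (M : ℚ) + 1 ≠ 0 := by positivity
    push_cast
    field_simp
    ring
  · have hN : lam.colLen 0 ≤ M :=
      Nat.lt_succ_iff.1 (colLen_zero_lt_of_ne_columnDiagram hM hcol)
    have hrowM : lam.rowLen M = 0 := rowLen_eq_zero_of_colLen_le (by omega)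
    -- The last of the `M + 1` parts is zero and contributes the factor `v`.
    have hphi : ∀ v : ℚ, shiftedPartsProduct lam v =
        v * ∏ i ∈ Finset.range M, (shiftedRow lam M i + 1 + v) := by
      intro v
      rw [shiftedPartsProduct_eq, hM, Finset.prod_range_succ, hrowM, mul_comm]
      congr 1
      · push_cast
        ring
      · refine Finset.prod_congr rfl fun i _ => ?_
        unfold shiftedRow
        push_cast
        ring
    have hH : (hookProduct lam : ℚ) ≠ 0 := by exact_mod_cast (hookProduct_pos lam).ne'
    have hid := shifted_prod_sub (Finset.range M) (shiftedRow lam M)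
      (shiftedRow_injective lam M).injOn
      (by rw [sum_shiftedRow lam M hN, hM, Finset.card_range]; push_cast; rfl) u
    have hcor : ∀ c ∈ corners lam, shiftedHookQuotient (removeCell lam c) u =
        cornerWeight (Finset.range M) (shiftedRow lam M) c.1 * (∏ j ∈ Finset.range M,
          (shiftedRow lam M j + u - if j = c.1 then 1 else 0)) / hookProduct lam := by
      intro c hc
      have hcard := card_removeCell hc
      have hH' : (hookProduct (removeCell lam c) : ℚ) ≠ 0 := by
        exact_mod_cast (hookProduct_pos _).ne'
      have hprod : shiftedPartsProduct (removeCell lam c) u =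
          ∏ j ∈ Finset.range M, (shiftedRow lam M j + u - if j = c.1 then 1 else 0) := by
        rw [shiftedPartsProduct_eq, show (removeCell lam c).card = M by omega]
        refine Finset.prod_congr rfl fun i _ => ?_
        have h := shiftedRow_removeCell hc M i
        rw [add_sub_right_comm (shiftedRow lam M i), ← h]
        unfold shiftedRow
        ring
      rw [shiftedHookQuotient, hprod, div_eq_div_iff hH' hH,
        ← cornerWeight_mul_hookProduct hc M hN]
      ring
    rw [Finset.sum_congr rfl hcor, ← sum_range_eq_sum_corners lam M hN
      (fun r => cornerWeight (Finset.range M) (shiftedRow lam M) r * (∏ j ∈ Finset.range M,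
          (shiftedRow lam M j + u - if j = r then 1 else 0)) / hookProduct lam)
      (fun r hr h => by rw [cornerWeight_eq_zero lam M r hN hr h]; simp),
      ← Finset.sum_div, ← hid, shiftedHookQuotient, shiftedHookQuotient, hphi, hphi, sub_div]
    congr 3
    refine Finset.prod_congr rfl fun i _ => ?_
    ring

/-- The right-hand side of the expansion of `A_λ(u)` into numbers of skew tableaux. -/
noncomputable def skewSYTSum (lam : YoungDiagram) (u : ℕ) : ℤ :=
  ∑ i ∈ Finset.range (lam.card + 1),
    Ring.choose ((u : ℤ) + (lam.card : ℤ) - (i : ℤ) - 1) (lam.card - i) *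
      (skewSYTCount lam (columnDiagram i) : ℤ)

/-- The expansion satisfies the same difference equation as `A_λ`: Pascal's rule together with the
branching rule. -/
theorem skewSYTSum_succ_sub (lam : YoungDiagram) {M : ℕ} (hM : lam.card = M + 1) (u : ℕ) :
    skewSYTSum lam (u + 1) - skewSYTSum lam u =
      ∑ c ∈ corners lam, skewSYTSum (removeCell lam c) (u + 1) := by
  have hcor : ∀ c ∈ corners lam, skewSYTSum (removeCell lam c) (u + 1) =
      ∑ i ∈ Finset.range (M + 1), Ring.choose ((u : ℤ) + M - i) (M - i) *
        (skewSYTCount (removeCell lam c) (columnDiagram i) : ℤ) := by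
    intro c hc
    have hcard := card_removeCell hc
    rw [skewSYTSum, show (removeCell lam c).card = M by omega]
    refine Finset.sum_congr rfl fun i _ => ?_
    congr 2
    push_cast
    ring
  rw [Finset.sum_congr rfl hcor, Finset.sum_comm, skewSYTSum, skewSYTSum, hM,
    Finset.sum_range_succ, Finset.sum_range_succ _ (M + 1), Nat.sub_self, Ring.choose_zero_right,
    Ring.choose_zero_right, add_sub_add_right_eq_sub, ← Finset.sum_sub_distrib]
  refine Finset.sum_congr rfl fun i hi => ?_
  have hi' := Finset.mem_range.1 hi
  have hne : columnDiagram i ≠ lam := fun h => by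
    have := card_columnDiagram i
    rw [h] at this
    omega
  rw [skewSYTCount_eq_sum_corners hne, ← sub_mul, Nat.cast_sum, Finset.mul_sum]
  refine Finset.sum_congr rfl fun c _ => ?_
  congr 1
  have h := Ring.choose_succ_succ ((u : ℤ) + M - i) (M - i)
  rw [show M + 1 - i = M - i + 1 by omega, sub_eq_iff_eq_add]
  convert h using 2
  · push_cast
    ring
  · congr 1
    push_cast
    ring

theorem skewSYTSum_zero (lam : YoungDiagram) :
    skewSYTSum lam 0 = skewSYTCount lam (columnDiagram lam.card) := by
  rw [skewSYTSum, Finset.sum_range_succ, Nat.sub_self, Ring.choose_zero_right, one_mul,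
    Finset.sum_eq_zero, zero_add]
  intro i hi
  have hi' := Finset.mem_range.1 hi
  have h : ((0 : ℕ) : ℤ) + (lam.card : ℤ) - (i : ℤ) - 1 = ((lam.card - i - 1 : ℕ) : ℤ) := by
    omega
  rw [h, Ring.choose_natCast, Nat.choose_eq_zero_of_lt (by omega)]
  simp

/-- Both sides are `1` if `λ` is a column and `0` otherwise. -/
theorem shiftedHookQuotient_zero (lam : YoungDiagram) :
    shiftedHookQuotient lam 0 = skewSYTCount lam (columnDiagram lam.card) := by
  by_cases hcol : columnDiagram lam.card = lam
  · have h1 : skewSYTCount lam (columnDiagram lam.card) = 1 := by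
      conv_lhs => rw [hcol]
      exact skewSYTCount_self lam
    rw [h1]
    conv_lhs => rw [← hcol]
    rw [shiftedHookQuotient_columnDiagram, ← Finset.prod_range_add_one_eq_factorial]
    push_cast
    simp only [zero_add]
    exact div_self (Finset.prod_ne_zero_iff.2 fun i _ => by positivity)
  · rw [skewSYTCount_of_not_le fun h => hcol (eq_columnDiagram_of_le rfl h), shiftedHookQuotient,
      shiftedPartsProduct_eq]
    -- There are fewer than `n` rows, so the factor of the `n`-th part is `0`.
    have hlt := colLen_zero_lt_of_ne_columnDiagram rfl hcol
    obtain ⟨M, hM⟩ := Nat.exists_eq_add_of_le' (Nat.zero_lt_of_lt hlt)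
    rw [hM] at hlt
    have hrowM : lam.rowLen M = 0 := rowLen_eq_zero_of_colLen_le (by omega)
    rw [hM, Finset.prod_range_succ, hrowM]
    push_cast
    simp

theorem shiftedHookQuotient_eq_skewSYTSum (lam : YoungDiagram) (u : ℕ) :
    shiftedHookQuotient lam u = skewSYTSum lam u := by
  induction hn : lam.card generalizing lam u with
  | zero =>
    have h : lam = columnDiagram 0 :=
      (eq_columnDiagram_of_le hn fun ⟨i, j⟩ hij =>
        absurd (mem_columnDiagram.1 hij).1 (by omega)).symm
    have h2 : skewSYTCount lam (columnDiagram 0) = 1 := by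
      rw [← h]
      exact skewSYTCount_self lam
    rw [skewSYTSum, hn, Finset.sum_range_one, h2, Ring.choose_zero_right]
    rw [h, shiftedHookQuotient_columnDiagram]
    simp
  | succ M ih =>
    induction u with
    | zero =>
      rw [skewSYTSum_zero, Nat.cast_zero, shiftedHookQuotient_zero]
      push_cast
      rfl
    | succ u ihu =>
      have h1 := shiftedHookQuotient_sub lam hn ((u + 1 : ℕ) : ℚ)
      have h2 := congrArg (Int.cast : ℤ → ℚ) (skewSYTSum_succ_sub lam hn u)
      have h3 : ∀ c ∈ corners lam, shiftedHookQuotient (removeCell lam c) ((u + 1 : ℕ) : ℚ) =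
          skewSYTSum (removeCell lam c) (u + 1) := fun c hc =>
        ih _ _ (Nat.succ_injective ((card_removeCell hc).trans hn))
      rw [Finset.sum_congr rfl h3, show ((u + 1 : ℕ) : ℚ) - 1 = u by push_cast; ring, ihu] at h1
      rw [Int.cast_sub, Int.cast_sum, ← h1] at h2
      linarith

theorem corollary2p2 (n u : ℕ) (lam : YoungDiagram) (hn : lam.card = n) :
    (1 ≤ u →
      shiftedHookQuotient lam (u : ℚ) =
          (∏ v ∈ (stackedDiagram u lam).row 0, (hookLength (stackedDiagram u lam) v : ℚ)) /
            (hookProduct lam.transpose : ℚ) ∧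
      shiftedHookQuotient lam (u : ℚ) =
          (∏ v ∈ (stackedDiagram u lam).row 0, (hookLength (stackedDiagram u lam) v : ℚ)) /
            (hookProduct lam : ℚ) ∧
      shiftedHookQuotient lam (u : ℚ) =
          (hookProduct (stackedDiagram u lam) : ℚ) /
            ((hookProduct lam : ℚ) * (hookProduct (stackedDiagram (u - 1) lam) : ℚ)) ∧
      (u = 1 →
        shiftedHookQuotient lam (u : ℚ) =
          (hookProduct (stackedDiagram u lam) : ℚ) / (hookProduct lam : ℚ) ^ 2)) ∧
    shiftedHookQuotient lam (u : ℚ) =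
      ∑ i ∈ Finset.range (n + 1),
        ((Ring.choose ((u : ℤ) + (n : ℤ) - (i : ℤ) - 1) (n - i) : ℤ) : ℚ) *
          (skewSYTCount lam (columnDiagram i) : ℚ) ∧
    (∃ z : ℤ, shiftedHookQuotient lam (u : ℚ) = (z : ℚ)) := by
  have hH : (hookProduct lam : ℚ) ≠ 0 := by exact_mod_cast (hookProduct_pos lam).ne'
  have hmain := shiftedHookQuotient_eq_skewSYTSum lam u
  refine ⟨fun hu => ?_, ?_, skewSYTSum lam u, hmain⟩
  · obtain ⟨w, rfl⟩ := Nat.exists_eq_add_of_le' hu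
    have hS : (hookProduct (stackedDiagram w lam) : ℚ) ≠ 0 := by
      exact_mod_cast (hookProduct_pos _).ne'
    have hquot : shiftedHookQuotient lam ((w + 1 : ℕ) : ℚ) =
        (hookProduct (stackedDiagram (w + 1) lam) : ℚ) /
          ((hookProduct lam : ℚ) * (hookProduct (stackedDiagram w lam) : ℚ)) := by
      rw [hookProduct_stackedDiagram_succ, Nat.cast_mul, Nat.cast_prod,
        ← shiftedPartsProduct_eq_prod_row, mul_div_mul_right _ _ hS]
      rfl
    refine ⟨?_, ?_, hquot, fun h1 => ?_⟩
    · rw [hookProduct_transpose, ← shiftedPartsProduct_eq_prod_row]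
      rfl
    · rw [← shiftedPartsProduct_eq_prod_row]
      rfl
    · obtain rfl : w = 0 := by omega
      rw [hquot, stackedDiagram_zero, hookProduct_transpose, sq]
  · subst hn
    rw [hmain, skewSYTSum]
    push_cast
    rfl
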